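/- Let $E$ be a Polish space with its Borel $\sigma$-algebra, let $n\ge 0$, and let $\mu_0,\dots,\mu_n=\mu$ be probability measures on $E$ such that $\mu_{k+1}\ll\mu_k$ for $0\le k\le n-1$, with a bounded density $g_{k,k+1}=d\mu_{k+1}/d\mu_k\ge 0$ (a fixed version). Put $\Gamma_g=\max_{0\le k\le n-1}\|g_{k,k+1}\|_\infty<\infty$, where $\|f\|_\infty=\sup_{x\in E}|f(x)|$. For $1\le k\le n$ let $K_k$ be a Markov kernel on $E$ that leaves $\mu_k$ invariant, with $K_kf(x)=\int f(y)\,K_k(x,dy)$, and let $G_{k,k+1}f=g_{k,k+1}f$. SMC sampler with $N$ particles: $\xi_0^1,\dots,\xi_0^N$ are i.i.d. from $\mu_0$. Given $\xi_k^1,\dots,\xi_k^N$ with $0\le k\le n-1$, draw $\hat\xi_k^1,\dots,\hat\xi_k^N$ i.i.d., each equal to $\xi_k^i$ with probability $g_{k,k+1}(\xi_k^i)/\sum_j g_{k,k+1}(\xi_k^j)$ (uniformly, if this sum is $0$); then draw, independently, $\xi_{k+1}^i\sim K_{k+1}(\hat\xi_k^i,\cdot)$ for $i=1,\dots,N$.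 Let $\mu_n^N=\frac1N\sum_{i=1}^N\delta_{\xi_n^i}$. For $1\le k\le n-1$ let $E=\bigsqcup_{r=1}^{m(k)}F_k^{(r)}$ be a measurable partition (the modes at stage $k$). Mixing between modes is allowed. Let $$B_{k,k+1}=\max_{1\le r\le m(k)}\frac{\mu_{k+1}(F_k^{(r)})}{\mu_k(F_k^{(r)})},\qquad \mu_{k,r}(S)=\frac{\mu_k(S\cap F_k^{(r)})}{\mu_k(F_k^{(r)})},\qquad \hat\mu_kf(x)=\sum_{r=1}^{m(k)}\alpha_{k,r}(x)\,\mu_{k,r}(f),$$ where the $\alpha_{k,r}(x)\ge 0$ are arbitrary with $\sum_r\alpha_{k,r}(x)\le 1$ for all $x\in E$ (if $\mu_k(F_k^{(r)})=0$, the ratio is read as $0$ and $\mu_{k,r}$ as the zero measure). For an operator $L$ on bounded measurable functions let $\|L\|_\infty$ be the supremum of $\|Lf\|_\infty$ over measurable $f$ with $\|f\|_\infty\le 1$. For bounded measurable $f$ and $0\le k\le n$ let $$V_{k,n}(f)=\|G_{k,k+1}K_{k+1}G_{k+1,k+2}K_{k+2}\cdots G_{n-1,n}K_nf\|_{L^2(\mu_k)}^2,\qquad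 V_{n,n}(f)=\|f\|_{L^2(\mu_n)}^2.$$ Theorem. Let $\varphi:E\to\mathbb R$ be bounded and measurable, and let $\bar\varphi=\varphi-\mu(\varphi)$. Then, as $N\to\infty$, $$\sqrt N\,\bigl(\mu_n^N(\varphi)-\mu(\varphi)\bigr)\longrightarrow\mathcal N\Bigl(0,\ \sum_{k=0}^nV_{k,n}(\bar\varphi)\Bigr)\quad\text{in distribution},$$ and for every $0\le k\le n-1$ and both for $\psi=\bar\varphi$ and for $\psi=\varphi$, $$V_{k,n}(\psi)\le\Gamma_g\prod_{j=k+1}^{n-1}\Bigl(B_{j,j+1}+\Gamma_g\,\|K_j-\hat\mu_j\|_\infty\Bigr)\|\varphi\|_\infty^2 .$$ -/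

import Mathlib

open MeasureTheory ProbabilityTheory Filter
open scoped NNReal ENNReal

set_option linter.unusedSectionVars false

namespace SMC

noncomputable section

variable {E : Type*} [MeasurableSpace E]

/-- The supremum norm `‖f‖_∞ = sup_x |f x|`; it is only used for bounded functions. -/
def supNorm {X : Type*} (f : X → ℝ) : ℝ := ⨆ x, |f x|

/-- The norm of an operator `L` on bounded functions: the supremum of `‖L f‖_∞` over the
measurable test functions `f` with `‖f‖_∞ ≤ 1`; it is only used for operators for which this
supremum is finite. -/
def opSupNorm (L : (E → ℝ) → E → ℝ) : ℝ :=
  sSup {r : ℝ | ∃ f : E → ℝ, Measurable f ∧ (∀ x, |f x| ≤ 1) ∧ r = supNorm (L f)}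

/-- The action of a kernel on functions, `(K f)(x) = ∫ f(y) K(x, dy)`. -/
def kernelOp (K : Kernel E E) (f : E → ℝ) : E → ℝ := fun x => ∫ y, f y ∂(K x)

/-! ### Sampling steps as Markov kernels on particle configurations -/

/-- The kernel that, given `x`, samples independent coordinates, the `i`-th one from `κ i x`. -/
def indepKernel {X : Type*} [MeasurableSpace X] {N : ℕ} (κ : Fin N → Kernel X E)
    [∀ i, IsMarkovKernel (κ i)] : Kernel X (Fin N → E) where
  toFun x := Measure.pi fun i => κ i x
  measurable' := by
    refine Measurable.measure_of_isPiSystem_of_isProbabilityMeasure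
      generateFrom_pi.symm isPiSystem_pi ?_
    rintro _ ⟨s, hs, rfl⟩
    simp only [Measure.pi_pi]
    exact Finset.measurable_fun_prod _
      fun i _ => Kernel.measurable_coe (κ i) (hs i (Set.mem_univ i))

instance {X : Type*} [MeasurableSpace X] {N : ℕ} (κ : Fin N → Kernel X E)
    [∀ i, IsMarkovKernel (κ i)] : IsMarkovKernel (indepKernel κ) :=
  ⟨fun x => by
    change IsProbabilityMeasure (Measure.pi fun i => κ i x)
    infer_instance⟩

/-- The probability `g(ξ i) / (g(ξ 1) + … + g(ξ N))` of selecting the particle `i`. If all the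
weights vanish, the selection is uniform. -/
def selectionWeight {N : ℕ} (g : E → ℝ≥0) (ξ : Fin N → E) (i : Fin N) : ℝ≥0 :=
  if ∑ j, g (ξ j) = 0 then (N : ℝ≥0)⁻¹ else g (ξ i) / ∑ j, g (ξ j)

/-- The law of one particle selected from the configuration `ξ`. -/
def selectionKernel {N : ℕ} (g : E → ℝ≥0) (hg : Measurable g) : Kernel (Fin N → E) E where
  toFun ξ := ∑ i, (selectionWeight g ξ i : ℝ≥0∞) • Measure.dirac (ξ i)
  measurable' := by
    refine Measure.measurable_of_measurable_coe _ fun s hs => ?_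
    simp only [Measure.finsetSum_apply, Measure.smul_apply, smul_eq_mul]
    refine Finset.measurable_fun_sum _ fun i _ => Measurable.mul ?_ ?_
    · refine Measurable.coe_nnreal_ennreal ?_
      have hsum : Measurable fun ξ : Fin N → E => ∑ j, g (ξ j) :=
        Finset.measurable_fun_sum _ fun j _ => hg.comp (measurable_pi_apply j)
      exact Measurable.ite (measurableSet_eq_fun hsum measurable_const) measurable_const
        ((hg.comp (measurable_pi_apply i)).div hsum)
    · exact (Measure.measurable_coe hs).comp (Measure.measurable_dirac.comp (measurable_pi_apply i))

lemma sum_selectionWeight {N : ℕ} [NeZero N] (g : E → ℝ≥0) (ξ : Fin N → E) :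
    ∑ i, selectionWeight g ξ i = 1 := by
  unfold selectionWeight
  split_ifs with h
  · have : (N : ℝ≥0) ≠ 0 := by exact_mod_cast NeZero.ne N
    simp [this]
  · rw [← Finset.sum_div]
    exact div_self h

lemma isMarkovKernel_selectionKernel {N : ℕ} [NeZero N] (g : E → ℝ≥0) (hg : Measurable g) :
    IsMarkovKernel (selectionKernel (N := N) g hg) :=
  ⟨fun ξ => ⟨by
    change (∑ i, (selectionWeight g ξ i : ℝ≥0∞) • Measure.dirac (ξ i)) Set.univ = 1
    simp only [Measure.finsetSum_apply, Measure.smul_apply, smul_eq_mul, measure_univ, mul_one]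
    exact_mod_cast sum_selectionWeight g ξ⟩⟩

lemma isMarkovKernel_selectionKernel_of_index {N : ℕ} (g : E → ℝ≥0) (hg : Measurable g)
    (i : Fin N) : IsMarkovKernel (selectionKernel (N := N) g hg) :=
  haveI : NeZero N := ⟨fun h => (h ▸ i).elim0⟩
  isMarkovKernel_selectionKernel g hg

/-- Multinomial resampling: `N` i.i.d. selections from the current configuration. -/
def resamplingKernel {N : ℕ} (g : E → ℝ≥0) (hg : Measurable g) :
    Kernel (Fin N → E) (Fin N → E) :=
  @indepKernel E _ (Fin N → E) _ N (fun _ => selectionKernel g hg)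
    (isMarkovKernel_selectionKernel_of_index g hg)

instance {N : ℕ} (g : E → ℝ≥0) (hg : Measurable g) :
    IsMarkovKernel (resamplingKernel (N := N) g hg) := by
  unfold resamplingKernel
  infer_instance

/-- Mutation: the particles move independently, the `i`-th one according to `K (ξ i)`. -/
def mutationKernel {N : ℕ} (K : Kernel E E) [IsMarkovKernel K] :
    Kernel (Fin N → E) (Fin N → E) :=
  indepKernel fun i : Fin N => K.comap (fun ξ : Fin N → E => ξ i) (measurable_pi_apply i)

instance {N : ℕ} (K : Kernel E E) [IsMarkovKernel K] :
    IsMarkovKernel (mutationKernel (N := N) K) := by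
  unfold mutationKernel; infer_instance

end

end SMC

open SMC

/-- The data of a sequential Monte Carlo sampler with `n` resampling stages on `E`: probability
measures `μ 0, …, μ n`, bounded versions `g k` of the densities `dμ (k+1) / dμ k` for `k < n`, and
Markov kernels `K 1, …, K n`, where `K k` leaves `μ k` invariant. The entries of the three
sequences beyond these ranges play no role. -/
structure SMCSampler (E : Type*) [MeasurableSpace E] (n : ℕ) where
  μ : ℕ → Measure E
  g : ℕ → E → ℝ≥0
  K : ℕ → Kernel E E
  isProbabilityMeasure_μ : ∀ k, IsProbabilityMeasure (μ k)
  isMarkovKernel_K : ∀ k, IsMarkovKernel (K k)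
  measurable_g : ∀ k, Measurable (g k)
  density : ∀ k < n, μ (k + 1) = (μ k).withDensity fun x => (g k x : ℝ≥0∞)
  bounded : ∀ k < n, ∃ C : ℝ≥0, ∀ x, g k x ≤ C
  invariant : ∀ k, 1 ≤ k → k ≤ n → (K k).Invariant (μ k)

namespace SMCSampler

noncomputable section

variable {E : Type*} [MeasurableSpace E] {n : ℕ} (S : SMCSampler E n)

instance (k : ℕ) : IsProbabilityMeasure (S.μ k) := S.isProbabilityMeasure_μ k
instance (k : ℕ) : IsMarkovKernel (S.K k) := S.isMarkovKernel_K k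

/-- The law of the configuration of `N` particles at stage `k`: the initial particles are
i.i.d. from `μ 0`, and the step from `k` to `k + 1` is a multinomial resampling with weights
`g k`, followed by a mutation with `K (k + 1)`. -/
def particleLaw (N : ℕ) : ℕ → Measure (Fin N → E)
  | 0 => Measure.pi fun _ => S.μ 0
  | k + 1 => ((particleLaw N k).bind (resamplingKernel (S.g k) (S.measurable_g k))).bind
      (mutationKernel (S.K (k + 1)))

instance (N k : ℕ) : IsProbabilityMeasure (S.particleLaw N k) := by
  induction k with
  | zero => unfold particleLaw; infer_instance
  | succ k ih => unfold particleLaw; infer_instance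

/-- The estimation error `√N (μ_n^N(φ) - μ_n(φ))` for the configuration `ξ`, where `μ_n^N` is the
empirical measure of `ξ`. -/
def scaledError (φ : E → ℝ) (N : ℕ) (ξ : Fin N → E) : ℝ :=
  √(N : ℝ) * ((1 / (N : ℝ)) * ∑ i, φ (ξ i) - ∫ x, φ x ∂(S.μ n))

/-- The operator `G_{k,k+1} f = g_{k,k+1} f`. -/
def G (k : ℕ) (f : E → ℝ) : E → ℝ := fun x => (S.g k x : ℝ) * f x

/-- `S.Q k d` is `G_{k,k+1} K_{k+1} G_{k+1,k+2} K_{k+2} ⋯ G_{k+d-1,k+d} K_{k+d}`. -/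
def Q : ℕ → ℕ → (E → ℝ) → E → ℝ
  | _, 0, f => f
  | k, d + 1, f => S.G k (kernelOp (S.K (k + 1)) (Q (k + 1) d f))

/-- The variance term `V_{k,n}(f) = ‖G_{k,k+1} K_{k+1} ⋯ G_{n-1,n} K_n f‖²` in `L²(μ k)`, for
`k ≤ n`; in particular `V_{n,n}(f) = ‖f‖²` in `L²(μ n)`, which is the variance of `f` if `f` has
mean zero. -/
def V (k : ℕ) (f : E → ℝ) : ℝ := ∫ x, (S.Q k (n - k) f x) ^ 2 ∂(S.μ k)

/-- `φ - μ_n(φ)`. -/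
def centered (φ : E → ℝ) : E → ℝ := fun x => φ x - ∫ y, φ y ∂(S.μ n)

/-- `Γ_g`, the maximum of `‖g_{k,k+1}‖_∞` over `k < n`. -/
def Γg : ℝ := ⨆ k : Fin n, supNorm fun x => (S.g k x : ℝ)

/-- The growth-within-mode constant `B_{k,k+1}` for the modes `F r` of stage `k`: the maximum over
`r` of `μ_{k+1}(F r) / μ_k(F r)`. -/
def growth (k : ℕ) {m : ℕ} (F : Fin m → Set E) : ℝ :=
  ⨆ r, (S.μ (k + 1)).real (F r) / (S.μ k).real (F r)

/-- The metastable approximation at stage `k`: the operator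
`f ↦ ∑ r, α r x * μ_{k,r}(f)`, where `μ_{k,r}` is the normalized restriction of `μ_k` to `F r`
(the zero measure if `F r` has mass zero). -/
def metastableOp (k : ℕ) {m : ℕ} (F : Fin m → Set E) (α : Fin m → E → ℝ) (f : E → ℝ) :
    E → ℝ :=
  fun x => ∑ r, α r x * ∫ y, f y ∂(ProbabilityTheory.cond (S.μ k) (F r))

end

end SMCSampler

/-! Central limit theorem. Given the configuration ξ at stage k, the particles at stage k + 1 are
i.i.d. from `S.step N k ξ`. Let m(ξ), w(ξ) be the means of f, f² under this law and v = μ_{k+1}(f²).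
The conditional characteristic function of √N times the average of f is exp(i t √N m(ξ) - t² v / 2)
up to O(1/√N + m² + |w - v|) (`exists_norm_charFun_pow_sub_le`). If μ_{k+1}(f) = 0, then m(ξ)
differs from the particle average of G K f by m(ξ) (1 - avg g) (`integral_step`), a product of two
quantities of order 1/√N in mean square (`meanSquareRate`). Hence √N m(ξ) may be replaced by the
scaled average of G K f at stage k. This gives an induction on k (`charFun_rate`) in which each
stage adds one variance term; Lévy's continuity theorem concludes.

Variance bound. By Cauchy–Schwarz, (K_j(g u))² ≤ K_j g · K_j(g u²). Integrating against μ_j, with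
invariance and the density, shows that a stage costs sup K_j g instead of sup g
(`integral_sq_kernelOp_G_le`). The metastable operator sends g to a subconvex combination of growth
ratios, so comparing K_j with it bounds sup K_j g by the factor in the product (`kernelOp_g_le`).
The outermost G has no kernel before it and costs Γ_g; the last kernel is an L² contraction. -/

namespace SMC

noncomputable section

/-! ### Bounded measurable functions -/

/-- `f` is measurable and bounded by `C`. -/
structure IsBM {X : Type*} [MeasurableSpace X] (f : X → ℝ) (C : ℝ) : Prop where
  meas : Measurable f
  bound : ∀ x, |f x| ≤ C

namespace IsBM

variable {X : Type*} [MeasurableSpace X] {f h : X → ℝ} {C D : ℝ}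

lemma mul (hf : IsBM f C) (hh : IsBM h D) : IsBM (fun x => f x * h x) (C * D) :=
  ⟨hf.meas.mul hh.meas, fun x => by
    rw [abs_mul]
    exact mul_le_mul (hf.bound x) (hh.bound x) (abs_nonneg _) ((abs_nonneg _).trans (hf.bound x))⟩

lemma sq (hf : IsBM f C) : IsBM (fun x => f x ^ 2) (C ^ 2) := by
  simpa only [pow_two] using hf.mul hf

lemma sub_const (hf : IsBM f C) (c : ℝ) : IsBM (fun x => f x - c) (C + |c|) :=
  ⟨hf.meas.sub_const c, fun x => (abs_sub _ _).trans (by gcongr; exact hf.bound x)⟩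

lemma integrable (hf : IsBM f C) (ν : Measure X) [IsFiniteMeasure ν] : Integrable f ν :=
  Integrable.of_bound hf.meas.aestronglyMeasurable C (ae_of_all _ hf.bound)

lemma abs_integral_le (hf : IsBM f C) (ν : Measure X) [IsProbabilityMeasure ν] :
    |∫ x, f x ∂ν| ≤ C := by
  have h : ∀ x, ‖f x‖ ≤ C := hf.bound
  simpa using norm_integral_le_of_norm_le_const (μ := ν) (ae_of_all _ h)

lemma nonneg (hf : IsBM f C) [Nonempty X] : 0 ≤ C :=
  (abs_nonneg _).trans (hf.bound (Classical.arbitrary X))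

lemma integral_kernel {Y : Type*} [MeasurableSpace Y] (hf : IsBM f C) (κ : Kernel Y X)
    [IsMarkovKernel κ] : IsBM (fun y => ∫ x, f x ∂(κ y)) C :=
  ⟨(hf.meas.stronglyMeasurable.integral_kernel (κ := κ)).measurable,
    fun y => hf.abs_integral_le (κ y)⟩

lemma memLp_two (hf : IsBM f C) (ν : Measure X) [IsFiniteMeasure ν] : MemLp f 2 ν :=
  MemLp.of_bound hf.meas.aestronglyMeasurable C (ae_of_all _ hf.bound)

end IsBM

lemma integral_comp_kernel {X Y F : Type*} [MeasurableSpace X] [MeasurableSpace Y]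
    [NormedAddCommGroup F] [NormedSpace ℝ F]
    (ν : Measure X) [IsProbabilityMeasure ν] (κ : Kernel X Y) [IsMarkovKernel κ]
    {f : Y → F} (hf : Integrable f (ν.bind κ)) :
    ∫ y, f y ∂(ν.bind κ) = ∫ x, ∫ y, f y ∂(κ x) ∂ν := by
  rw [Measure.comp_eq_comp_const_apply] at hf ⊢
  rw [Kernel.integral_comp hf]
  simp

/-! ### One step of the particle system -/

variable {E : Type*} [MeasurableSpace E]

lemma bind_mutationKernel {N : ℕ} (ν : Measure E) [IsProbabilityMeasure ν] (K : Kernel E E)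
    [IsMarkovKernel K] :
    (Measure.pi fun _ : Fin N => ν).bind (mutationKernel K)
      = Measure.pi fun _ : Fin N => ν.bind K := by
  refine (Measure.pi_eq fun s hs => ?_).symm
  rw [Measure.bind_apply (MeasurableSet.univ_pi hs) (Kernel.aemeasurable _)]
  have h1 : ∀ ξ : Fin N → E, mutationKernel K ξ (Set.univ.pi s) = ∏ i, K (ξ i) (s i) :=
    fun ξ => Measure.pi_pi (fun i => K (ξ i)) s
  simp_rw [h1]
  have h2 : ∀ i, Measurable fun x => K x (s i) := fun i => Kernel.measurable_coe K (hs i)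
  rw [lintegral_prod_eq_prod_lintegral_of_indepFun Finset.univ
    (fun i (ξ : Fin N → E) => K (ξ i) (s i))
    (iIndepFun_pi (X := fun i x => K x (s i)) fun i => (h2 i).aemeasurable)
    fun i => (h2 i).comp (measurable_pi_apply i)]
  refine Finset.prod_congr rfl fun i _ => ?_
  rw [Measure.bind_apply (hs i) (Kernel.aemeasurable _)]
  exact (measurePreserving_eval (fun _ : Fin N => ν) i).lintegral_comp (h2 i)

/-- Given the configuration `ξ`, the law of one particle after selection and mutation. -/
def stepKernel {N : ℕ} (g : E → ℝ≥0) (hg : Measurable g) (K : Kernel E E) :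
    Kernel (Fin N → E) E := K ∘ₖ selectionKernel g hg

instance {N : ℕ} [NeZero N] (g : E → ℝ≥0) (hg : Measurable g) (K : Kernel E E)
    [IsMarkovKernel K] : IsMarkovKernel (stepKernel (N := N) g hg K) := by
  have := isMarkovKernel_selectionKernel (N := N) g hg
  unfold stepKernel
  infer_instance

/-- Selections are i.i.d. given ξ and mutation acts coordinatewise, so one full step is
conditionally i.i.d.; all randomness can then be treated one stage at a time. -/
lemma mutation_comp_resampling {N : ℕ} [NeZero N] (g : E → ℝ≥0) (hg : Measurable g)
    (K : Kernel E E) [IsMarkovKernel K] (ξ : Fin N → E) :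
    (mutationKernel K ∘ₖ resamplingKernel g hg) ξ
      = Measure.pi fun _ : Fin N => stepKernel g hg K ξ := by
  have := isMarkovKernel_selectionKernel (N := N) g hg
  rw [Kernel.comp_apply]
  simp_rw [stepKernel, Kernel.comp_apply]
  exact bind_mutationKernel _ _

/-- The average of `f` over the particles of `ξ`. -/
def avg {N : ℕ} (f : E → ℝ) (ξ : Fin N → E) : ℝ := (N : ℝ)⁻¹ * ∑ i, f (ξ i)

lemma IsBM.avg {N : ℕ} [NeZero N] {f : E → ℝ} {C : ℝ} (hf : IsBM f C) :
    IsBM (avg (N := N) f) C := by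
  constructor
  · exact (Finset.measurable_fun_sum _ fun i _ => hf.meas.comp (measurable_pi_apply i)).const_mul _
  · intro ξ
    have hN : (0 : ℝ) < N := by exact_mod_cast Nat.pos_of_ne_zero (NeZero.ne N)
    have h1 : |∑ i, f (ξ i)| ≤ N * C := by
      refine (Finset.abs_sum_le_sum_abs _ _).trans ((Finset.sum_le_sum fun i _ =>
        hf.bound (ξ i)).trans (by simp))
    rw [SMC.avg, abs_mul, abs_of_pos (inv_pos.2 hN), inv_mul_le_iff₀ hN]
    exact h1

lemma avg_sub_const {N : ℕ} [NeZero N] (f : E → ℝ) (c : ℝ) (ξ : Fin N → E) :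
    avg (fun x => f x - c) ξ = avg f ξ - c := by
  have hN : (N : ℝ) ≠ 0 := by exact_mod_cast NeZero.ne N
  simp only [avg, Finset.sum_sub_distrib, Finset.sum_const, Finset.card_univ, Fintype.card_fin,
    nsmul_eq_mul]
  field_simp

lemma integral_stepKernel {N : ℕ} [NeZero N] (g : E → ℝ≥0) (hg : Measurable g)
    (K : Kernel E E) [IsMarkovKernel K] {f : E → ℝ} {C : ℝ} (hf : IsBM f C) (ξ : Fin N → E) :
    ∫ y, f y ∂(stepKernel g hg K ξ) = ∑ i, (selectionWeight g ξ i : ℝ) * kernelOp K f (ξ i) := by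
  have := isMarkovKernel_selectionKernel (N := N) g hg
  have hK : IsBM (kernelOp K f) C := hf.integral_kernel K
  rw [stepKernel, Kernel.comp_apply, integral_comp_kernel _ _ (hf.integrable _)]
  change ∫ x, kernelOp K f x ∂(∑ i, (selectionWeight g ξ i : ℝ≥0∞) • Measure.dirac (ξ i)) = _
  rw [integral_finsetSum_measure fun i _ => (hK.integrable _).smul_measure ENNReal.coe_ne_top]
  refine Finset.sum_congr rfl fun i _ => ?_
  rw [integral_smul_measure, integral_dirac' _ _ hK.meas.stronglyMeasurable]
  simp

/-- Also valid when all the weights vanish. -/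
lemma avg_mul_integral_stepKernel {N : ℕ} [NeZero N] (g : E → ℝ≥0) (hg : Measurable g)
    (K : Kernel E E) [IsMarkovKernel K] {f : E → ℝ} {C : ℝ} (hf : IsBM f C) (ξ : Fin N → E) :
    avg (fun x => (g x : ℝ)) ξ * ∫ y, f y ∂(stepKernel g hg K ξ)
      = avg (fun x => (g x : ℝ) * kernelOp K f x) ξ := by
  rw [integral_stepKernel g hg K hf, avg, avg, mul_assoc, Finset.mul_sum]
  congr 1
  refine Finset.sum_congr rfl fun i _ => ?_
  rw [← mul_assoc]
  congr 1
  -- If the total weight is 0, every g (ξ i) is 0, so the uniform choice does no harm.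
  have h : (∑ j, g (ξ j)) * selectionWeight g ξ i = g (ξ i) := by
    unfold selectionWeight
    split_ifs with h
    · rw [h, zero_mul]
      exact (Finset.sum_eq_zero_iff.1 h i (Finset.mem_univ i)).symm
    · exact mul_div_cancel₀ _ h
  exact_mod_cast h

lemma integral_avg_sub_sq_le {N : ℕ} [NeZero N] (ν : Measure E) [IsProbabilityMeasure ν]
    {f : E → ℝ} {C : ℝ} (hf : IsBM f C) :
    ∫ ξ, (avg f ξ - ∫ x, f x ∂ν) ^ 2 ∂(Measure.pi fun _ : Fin N => ν) ≤ C ^ 2 / N := by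
  have hN : (N : ℝ) ≠ 0 := by exact_mod_cast NeZero.ne N
  set P := Measure.pi fun _ : Fin N => ν
  have hmean : ∫ ξ, avg f ξ ∂P = ∫ x, f x ∂ν := by
    have hi : ∀ i, Integrable (fun ξ : Fin N → E => f (ξ i)) P := fun i =>
      (measurePreserving_eval (fun _ : Fin N => ν) i).integrable_comp_of_integrable
        (hf.integrable ν)
    simp only [avg]
    rw [integral_const_mul, integral_finsetSum _ fun i _ => hi i]
    have : ∀ i, ∫ ξ : Fin N → E, f (ξ i) ∂P = ∫ x, f x ∂ν := fun i =>
      integral_comp_eval (μ := fun _ : Fin N => ν) (i := i) hf.meas.aestronglyMeasurable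
    simp only [this, Finset.sum_const, Finset.card_univ, Fintype.card_fin, nsmul_eq_mul]
    field_simp
  have hvar : Var[avg (N := N) f; P] = (N : ℝ)⁻¹ ^ 2 * (N * Var[f; ν]) := by
    have h1 := variance_sum_pi (μ := fun _ : Fin N => ν) (X := fun _ => f)
      fun _ => hf.memLp_two ν
    have h2 : (avg (N := N) f) = fun ξ => (N : ℝ)⁻¹ * (∑ i, fun ξ : Fin N → E => f (ξ i)) ξ := by
      funext ξ
      simp [avg]
    rw [h2, variance_const_mul, h1]
    simp
  have hle : Var[f; ν] ≤ C ^ 2 :=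
    (variance_le_expectation_sq hf.meas.aestronglyMeasurable).trans
      ((le_abs_self _).trans (hf.sq.abs_integral_le ν))
  rw [← hmean, ← variance_eq_integral (hf.avg (N := N)).meas.aemeasurable, hvar]
  calc (N : ℝ)⁻¹ ^ 2 * (N * Var[f; ν]) = Var[f; ν] / N := by field_simp
    _ ≤ _ := by gcongr

/-! ### Characteristic functions of sums of bounded i.i.d. variables -/

lemma norm_pow_sub_pow_le {z w : ℂ} (hz : ‖z‖ ≤ 1) (hw : ‖w‖ ≤ 1) (N : ℕ) :
    ‖z ^ N - w ^ N‖ ≤ N * ‖z - w‖ := by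
  induction N with
  | zero => simp
  | succ N ih =>
    have h : z ^ (N + 1) - w ^ (N + 1) = z ^ N * (z - w) + (z ^ N - w ^ N) * w := by ring
    rw [h]
    refine (norm_add_le _ _).trans ?_
    rw [norm_mul, norm_mul, norm_pow]
    have h1 : ‖z‖ ^ N ≤ 1 := pow_le_one₀ (norm_nonneg _) hz
    have h2 : ‖z‖ ^ N * ‖z - w‖ ≤ 1 * ‖z - w‖ := by gcongr
    have h3 : ‖z ^ N - w ^ N‖ * ‖w‖ ≤ (N * ‖z - w‖) * 1 := by gcongr
    push_cast
    linarith

lemma norm_integral_exp_sub_le (ν : Measure E) [IsProbabilityMeasure ν] {f : E → ℝ} {C : ℝ}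
    (hf : IsBM f C) (s : ℝ) :
    ‖∫ x, Complex.exp (s * f x * Complex.I) ∂ν
      - (1 + s * (∫ x, f x ∂ν : ℝ) * Complex.I - s ^ 2 * (∫ x, f x ^ 2 ∂ν : ℝ) / 2)‖
      ≤ (|s| * C) ^ 3 * Real.exp (|s| * C) := by
  have hint : Integrable (fun x => Complex.exp (s * f x * Complex.I)) ν := by
    refine Integrable.of_bound ?_ 1 (ae_of_all _ fun x => ?_)
    · have := hf.meas
      exact Measurable.aestronglyMeasurable (by fun_prop)
    · have := Complex.norm_exp_ofReal_mul_I (s * f x)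
      push_cast at this
      exact this.le
  have i1 : Integrable (fun x => (f x : ℂ)) ν := (hf.integrable ν).ofReal
  have i2 : Integrable (fun x => ((f x ^ 2 : ℝ) : ℂ)) ν := (hf.sq.integrable ν).ofReal
  have hEq : ∫ x, Complex.exp (s * f x * Complex.I) ∂ν
      - (1 + s * (∫ x, f x ∂ν : ℝ) * Complex.I - s ^ 2 * (∫ x, f x ^ 2 ∂ν : ℝ) / 2)
      = ∫ x, (Complex.exp (s * f x * Complex.I)
        - (1 + (s * Complex.I) * f x - (s ^ 2 / 2) * ((f x ^ 2 : ℝ) : ℂ))) ∂ν := by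
    have j1 := i1.const_mul (s * Complex.I : ℂ)
    have j2 := i2.const_mul (s ^ 2 / 2 : ℂ)
    have j0 : Integrable (fun x => (1 : ℂ) + (s * Complex.I) * f x) ν := (integrable_const _).add j1
    have j3 : Integrable (fun x => 1 + (s * Complex.I) * f x
      - (s ^ 2 / 2) * ((f x ^ 2 : ℝ) : ℂ)) ν := j0.sub j2
    rw [integral_sub hint j3, integral_sub j0 j2, integral_add (integrable_const _) j1,
      integral_const_mul, integral_const_mul, integral_complex_ofReal, integral_complex_ofReal]
    simp only [integral_const, probReal_univ, one_smul]
    ring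
  rw [hEq]
  have hpt : ∀ x, ‖Complex.exp (s * f x * Complex.I)
        - (1 + (s * Complex.I) * f x - (s ^ 2 / 2) * ((f x ^ 2 : ℝ) : ℂ))‖
        ≤ (|s| * C) ^ 3 * Real.exp (|s| * C) := by
    intro x
    have h := Complex.norm_exp_sub_sum_le_norm_mul_exp (s * f x * Complex.I) 3
    have hn : ‖(s * f x * Complex.I : ℂ)‖ ≤ |s| * C := by
      simp only [norm_mul, Complex.norm_I, mul_one, Complex.norm_real, Real.norm_eq_abs]
      gcongr
      exact hf.bound x
    have hs : ∑ m ∈ Finset.range 3, (s * f x * Complex.I : ℂ) ^ m / (m.factorial : ℂ)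
        = (1 + (s * Complex.I) * f x - (s ^ 2 / 2) * ((f x ^ 2 : ℝ) : ℂ)) := by
      simp only [Finset.sum_range_succ, Finset.sum_range_zero]
      simp [Nat.factorial, mul_pow]
      ring
    rw [hs] at h
    have := (norm_nonneg _).trans hn
    exact h.trans (by gcongr)
  simpa using norm_integral_le_of_norm_le_const (μ := ν) (ae_of_all _ hpt)

/-- A is uniform in N, ν, f and v because ν will be the random law of a particle given the previous
stage. The deterministic v replaces the second moment under ν, and the mean under ν need not vanish.
-/
lemma exists_norm_charFun_pow_sub_le (C : ℝ) (hC : 0 ≤ C) (t : ℝ) : ∃ A : ℝ, 0 ≤ A ∧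
    ∀ (N : ℕ) [NeZero N] (ν : Measure E) [IsProbabilityMeasure ν] (f : E → ℝ), IsBM f C →
    ∀ v : ℝ, |v| ≤ C ^ 2 → 0 ≤ v →
    ‖(∫ x, Complex.exp ((t / √N : ℝ) * f x * Complex.I) ∂ν) ^ N
      - Complex.exp (t * (√N * ∫ x, f x ∂ν : ℝ) * Complex.I - t ^ 2 * v / 2)‖
      ≤ A * (1 / √N + (∫ x, f x ∂ν) ^ 2 + |(∫ x, f x ^ 2 ∂ν) - v|) := by
  -- R dominates both |s| C and ‖y‖ below, so e absorbs both exponential remainder factors.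
  obtain ⟨R, hR⟩ : ∃ R, R = |t| * C + t ^ 2 * C ^ 2 / 2 := ⟨_, rfl⟩
  obtain ⟨e, he⟩ : ∃ e, e = Real.exp R := ⟨_, rfl⟩
  have he0 : 0 < e := he ▸ Real.exp_pos R
  refine ⟨|t| ^ 3 * C ^ 3 * e + t ^ 4 * C ^ 4 / 4 * e + t ^ 2 * e + t ^ 2 / 2, by positivity, ?_⟩
  intro N _ ν _ f hf v hvC hv
  have hN1 : (1 : ℝ) ≤ N := by exact_mod_cast Nat.one_le_iff_ne_zero.2 (NeZero.ne N)
  have hr1 : 1 ≤ √(N : ℝ) := Real.one_le_sqrt.2 hN1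
  have hrr : √(N : ℝ) ^ 2 = N := Real.sq_sqrt (by linarith)
  set r := √(N : ℝ)
  have hr0 : 0 < r := by linarith
  set s := t / r with hs
  set m := ∫ x, f x ∂ν
  set w := ∫ x, f x ^ 2 ∂ν
  have hmC : |m| ≤ C := hf.abs_integral_le ν
  have hsabs : |s| = |t| / r := by rw [hs, abs_div, abs_of_pos hr0]
  have hst : |s| ≤ |t| := by rw [hsabs]; exact div_le_self (abs_nonneg _) hr1
  have hs2 : s ^ 2 * N = t ^ 2 := by rw [hs, ← hrr]; field_simp
  have hs2t : s ^ 2 ≤ t ^ 2 := sq_le_sq.2 hst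
  have h1 := norm_integral_exp_sub_le ν hf s
  set z := ∫ x, Complex.exp (s * f x * Complex.I) ∂ν
  -- One N-th of the target exponent; both 1 + y and the Taylor polynomial of z are compared with
  -- exp y.
  set y : ℂ := s * m * Complex.I - s ^ 2 * v / 2 with hy
  have hvle : v ≤ C ^ 2 := (le_abs_self v).trans hvC
  have hynorm : ‖y‖ ≤ R := by
    refine (norm_sub_le _ _).trans ?_
    have : ‖(s ^ 2 * v / 2 : ℂ)‖ = s ^ 2 * v / 2 := by
      rw [show (s ^ 2 * v / 2 : ℂ) = ((s ^ 2 * v / 2 : ℝ) : ℂ) by push_cast; rfl,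
        Complex.norm_real, Real.norm_of_nonneg (by positivity)]
    rw [this, hR]
    simp only [norm_mul, Complex.norm_I, mul_one, Complex.norm_real, Real.norm_eq_abs]
    gcongr
  have hynorm2 : ‖y‖ ^ 2 = s ^ 2 * m ^ 2 + s ^ 4 * v ^ 2 / 4 := by
    rw [show y = ((-(s ^ 2 * v / 2) : ℝ) : ℂ) + ((s * m : ℝ) : ℂ) * Complex.I by
      rw [hy]; push_cast; ring, Complex.sq_norm, Complex.normSq_add_mul_I]
    ring
  have h2 : ‖Complex.exp y - (1 + y)‖ ≤ (s ^ 2 * m ^ 2 + s ^ 4 * v ^ 2 / 4) * e := by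
    have h := Complex.norm_exp_sub_sum_le_norm_mul_exp y 2
    simp only [Finset.sum_range_succ, Finset.sum_range_zero, hynorm2] at h
    simp only [pow_zero, Nat.factorial, Nat.cast_one, div_one, zero_add, pow_one, mul_one] at h
    exact h.trans (by rw [he]; gcongr)
  have hz : ‖z‖ ≤ 1 := by
    have : ∀ x, ‖Complex.exp (s * f x * Complex.I)‖ ≤ 1 := fun x => by
      have := Complex.norm_exp_ofReal_mul_I (s * f x)
      push_cast at this
      exact this.le
    simpa using norm_integral_le_of_norm_le_const (μ := ν) (ae_of_all _ this)
  have hw1 : ‖Complex.exp y‖ ≤ 1 := by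
    rw [Complex.norm_exp, Real.exp_le_one_iff]
    have : y.re = -(s ^ 2 * v / 2) := by
      rw [show y = ((-(s ^ 2 * v / 2) : ℝ) : ℂ) + ((s * m : ℝ) : ℂ) * Complex.I by
        rw [hy]; push_cast; ring, Complex.add_re, Complex.ofReal_re, Complex.re_ofReal_mul]
      simp
    rw [this]
    have : 0 ≤ s ^ 2 * v / 2 := by positivity
    linarith
  have hpow : Complex.exp (t * (r * m : ℝ) * Complex.I - t ^ 2 * v / 2) = Complex.exp y ^ N := by
    rw [← Complex.exp_nat_mul]
    congr 1
    have e1 : (N : ℂ) * s = t * r := by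
      rw [hs, ← Complex.ofReal_natCast, ← hrr]; push_cast
      have : (r : ℂ) ≠ 0 := by exact_mod_cast hr0.ne'
      field_simp
    have e2 : (N : ℂ) * s ^ 2 = t ^ 2 := by
      rw [mul_comm]; exact_mod_cast hs2
    rw [hy]
    push_cast
    linear_combination (-(m : ℂ) * Complex.I) * e1 + (v / 2 : ℂ) * e2
  rw [hpow]
  refine (norm_pow_sub_pow_le hz hw1 N).trans ?_
  have htri : ‖z - Complex.exp y‖ ≤ (|s| * C) ^ 3 * Real.exp (|s| * C)
      + (s ^ 2 * m ^ 2 + s ^ 4 * v ^ 2 / 4) * e + s ^ 2 * |w - v| / 2 := by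
    have hdec : z - Complex.exp y = (z - (1 + s * (m : ℝ) * Complex.I - s ^ 2 * (w : ℝ) / 2))
        - (Complex.exp y - (1 + y)) - ((s ^ 2 * (w - v) / 2 : ℝ) : ℂ) := by
      rw [hy]; push_cast; ring
    rw [hdec]
    refine (norm_sub_le _ _).trans (add_le_add ((norm_sub_le _ _).trans (add_le_add h1 h2)) ?_)
    rw [Complex.norm_real, Real.norm_eq_abs, abs_div, abs_mul, abs_of_nonneg (sq_nonneg s)]
    simp
  have hexp : Real.exp (|s| * C) ≤ e := by
    rw [he]
    apply Real.exp_le_exp.2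
    have : |s| * C ≤ |t| * C := by gcongr
    have : 0 ≤ t ^ 2 * C ^ 2 / 2 := by positivity
    linarith
  have b1 : N * ((|s| * C) ^ 3 * Real.exp (|s| * C)) ≤ (|t| ^ 3 * C ^ 3 * e) * (1 / r) := by
    have : N * (|s| * C) ^ 3 = |t| ^ 3 * C ^ 3 * (1 / r) := by
      rw [hsabs, ← hrr]; field_simp
    rw [← mul_assoc, this]
    calc |t| ^ 3 * C ^ 3 * (1 / r) * Real.exp (|s| * C) ≤ |t| ^ 3 * C ^ 3 * (1 / r) * e := by gcongr
      _ = _ := by ring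
  have b2 : N * ((s ^ 2 * m ^ 2 + s ^ 4 * v ^ 2 / 4) * e)
      ≤ (t ^ 2 * e) * m ^ 2 + (t ^ 4 * C ^ 4 / 4 * e) * (1 / r) := by
    have e1 : N * ((s ^ 2 * m ^ 2 + s ^ 4 * v ^ 2 / 4) * e)
        = (t ^ 2 * e) * m ^ 2 + t ^ 4 * v ^ 2 / 4 * e * (1 / r) * (1 / r) := by
      rw [hs, ← hrr]; field_simp
    rw [e1]
    have hv2 : v ^ 2 ≤ C ^ 4 := by
      calc v ^ 2 ≤ (C ^ 2) ^ 2 := by gcongr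
        _ = C ^ 4 := by ring
    -- This term is of order 1/N; one factor 1 / r is given away.
    have hrle : 1 / r ≤ 1 := by rw [div_le_one hr0]; exact hr1
    have : t ^ 4 * v ^ 2 / 4 * e * (1 / r) * (1 / r) ≤ (t ^ 4 * C ^ 4 / 4 * e) * (1 / r) * 1 := by
      gcongr
    linarith
  have b3 : N * (s ^ 2 * |w - v| / 2) = t ^ 2 / 2 * |w - v| := by
    rw [← hs2]; ring
  have hfin : N * ‖z - Complex.exp y‖ ≤ (|t| ^ 3 * C ^ 3 * e) * (1 / r) +
      ((t ^ 2 * e) * m ^ 2 + (t ^ 4 * C ^ 4 / 4 * e) * (1 / r)) + t ^ 2 / 2 * |w - v| := by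
    calc _ ≤ N * ((|s| * C) ^ 3 * Real.exp (|s| * C)
      + (s ^ 2 * m ^ 2 + s ^ 4 * v ^ 2 / 4) * e + s ^ 2 * |w - v| / 2) := by gcongr
      _ ≤ _ := by rw [mul_add, mul_add, b3]; linarith
  refine hfin.trans ?_
  have p1 : 0 ≤ |t| ^ 3 * C ^ 3 * e := by positivity
  have p2 : 0 ≤ t ^ 4 * C ^ 4 / 4 * e := by positivity
  have p3 : 0 ≤ t ^ 2 * e := by positivity
  have p4 : 0 ≤ t ^ 2 / 2 := by positivity
  have q1 : 0 ≤ 1 / r := by positivity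
  have q2 : 0 ≤ m ^ 2 := by positivity
  have q3 : 0 ≤ |w - v| := abs_nonneg _
  generalize |t| ^ 3 * C ^ 3 * e = a1 at *
  generalize t ^ 4 * C ^ 4 / 4 * e = a2 at *
  generalize t ^ 2 * e = a3 at *
  generalize t ^ 2 / 2 = a4 at *
  linarith [mul_nonneg p1 q2, mul_nonneg p1 q3, mul_nonneg p2 q2, mul_nonneg p2 q3,
    mul_nonneg p3 q1, mul_nonneg p3 q3, mul_nonneg p4 q1, mul_nonneg p4 q2]

lemma integral_pi_exp_avg {N : ℕ} [NeZero N] (ν : Measure E) [IsProbabilityMeasure ν]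
    (f : E → ℝ) (t : ℝ) :
    ∫ ξ, Complex.exp (t * (√N * avg f ξ : ℝ) * Complex.I) ∂(Measure.pi fun _ : Fin N => ν)
      = (∫ x, Complex.exp ((t / √N : ℝ) * f x * Complex.I) ∂ν) ^ N := by
  have h := integral_fintype_prod_eq_pow (ι := Fin N) (μ := ν)
    (fun x => Complex.exp ((t / √N : ℝ) * f x * Complex.I))
  rw [Fintype.card_fin] at h
  rw [← h]
  congr 1
  funext ξ
  rw [← Complex.exp_sum]
  congr 1
  have hN : (0 : ℝ) < N := by exact_mod_cast Nat.pos_of_ne_zero (NeZero.ne N)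
  have hr : √(N : ℝ) * (N : ℝ)⁻¹ = 1 / √N := by
    have := Real.sq_sqrt hN.le
    have h0 := Real.sqrt_pos.2 hN
    nth_rw 2 [← this]
    field_simp
  rw [avg, ← mul_assoc, hr, ← Finset.sum_mul, ← Finset.mul_sum]
  push_cast
  ring

end

end SMC

namespace SMCSampler

noncomputable section

variable {E : Type*} [MeasurableSpace E] {n : ℕ} (S : SMCSampler E n)

/-! ### Identities between consecutive stages -/

lemma exists_isBM_g {k : ℕ} (hk : k < n) : ∃ C, IsBM (fun x => (S.g k x : ℝ)) C := by
  obtain ⟨C, hC⟩ := S.bounded k hk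
  exact ⟨C, (S.measurable_g k).coe_nnreal_real, fun x => by
    rw [abs_of_nonneg (S.g k x).coe_nonneg]; exact_mod_cast hC x⟩

lemma integral_succ {k : ℕ} (hk : k < n) (f : E → ℝ) :
    ∫ x, f x ∂(S.μ (k + 1)) = ∫ x, (S.g k x : ℝ) * f x ∂(S.μ k) := by
  rw [S.density k hk, integral_withDensity_eq_integral_smul (S.measurable_g k)]
  rfl

lemma isBM_kernelOp (k : ℕ) {f : E → ℝ} {C : ℝ} (hf : IsBM f C) :
    IsBM (kernelOp (S.K k) f) C := hf.integral_kernel (S.K k)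

lemma integral_kernelOp {k : ℕ} (hk : 1 ≤ k) (hkn : k ≤ n) {f : E → ℝ} {C : ℝ} (hf : IsBM f C) :
    ∫ x, kernelOp (S.K k) f x ∂(S.μ k) = ∫ x, f x ∂(S.μ k) := by
  have h : (S.μ k).bind (S.K k) = S.μ k := S.invariant k hk hkn
  have := integral_comp_kernel (S.μ k) (S.K k) (f := f) (h.symm ▸ hf.integrable _)
  rw [h] at this
  exact this.symm

/-- By invariance and the density, replacing f by G K f while going back one stage keeps the mean,
so the induction stays among centered functions. -/
lemma integral_G_kernelOp {k : ℕ} (hk : k < n) {f : E → ℝ} {C : ℝ} (hf : IsBM f C) :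
    ∫ x, S.G k (kernelOp (S.K (k + 1)) f) x ∂(S.μ k) = ∫ x, f x ∂(S.μ (k + 1)) := by
  rw [← S.integral_kernelOp (Nat.le_add_left 1 k) hk hf, S.integral_succ hk]
  rfl

lemma exists_isBM_G_kernelOp {k : ℕ} (hk : k < n) {f : E → ℝ} {C : ℝ} (hf : IsBM f C) :
    ∃ D, IsBM (S.G k (kernelOp (S.K (k + 1)) f)) D := by
  obtain ⟨D, hD⟩ := S.exists_isBM_g hk
  exact ⟨_, hD.mul (S.isBM_kernelOp (k + 1) hf)⟩

lemma integral_g {k : ℕ} (hk : k < n) : ∫ x, (S.g k x : ℝ) ∂(S.μ k) = 1 := by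
  have := S.integral_succ hk fun _ => 1
  simpa using this.symm

/-- The operator `Q` grows from the right. -/
lemma Q_succ_right (k d : ℕ) (f : E → ℝ) :
    S.Q k (d + 1) f = S.Q k d (S.G (k + d) (kernelOp (S.K (k + d + 1)) f)) := by
  induction d generalizing k with
  | zero => rfl
  | succ d ih =>
    rw [Q, ih (k + 1), Q]
    congr 3
    rw [show k + 1 + d = k + (d + 1) by ring]

/-! ### The law of the particles -/

/-- Given `ξ` at stage `k`, the law of one particle at stage `k + 1`. -/
def step (N k : ℕ) : Kernel (Fin N → E) E := stepKernel (S.g k) (S.measurable_g k) (S.K (k + 1))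

instance (N k : ℕ) [NeZero N] : IsMarkovKernel (S.step N k) := by
  unfold step
  infer_instance

lemma integral_particleLaw_succ {F : Type*} [NormedAddCommGroup F] [NormedSpace ℝ F]
    (N k : ℕ) [NeZero N] {f : (Fin N → E) → F} (hf : Integrable f (S.particleLaw N (k + 1))) :
    ∫ ξ, f ξ ∂(S.particleLaw N (k + 1))
      = ∫ ξ, ∫ ζ, f ζ ∂(Measure.pi fun _ : Fin N => S.step N k ξ) ∂(S.particleLaw N k) := by
  have h : S.particleLaw N (k + 1) = (S.particleLaw N k).bind
      (mutationKernel (S.K (k + 1)) ∘ₖ resamplingKernel (S.g k) (S.measurable_g k)) := by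
    rw [particleLaw, Measure.comp_assoc]
  rw [h] at hf ⊢
  rw [integral_comp_kernel _ _ hf]
  simp_rw [mutation_comp_resampling]
  rfl

/-- Linearizes the self-normalized ratio avg (G K f) / avg g. For centered f both factors on the
right are small, so the error is of second order. -/
lemma integral_step {N k : ℕ} [NeZero N] {f : E → ℝ} {C : ℝ} (hf : IsBM f C) (ξ : Fin N → E) :
    ∫ y, f y ∂(S.step N k ξ) - avg (S.G k (kernelOp (S.K (k + 1)) f)) ξ
      = (∫ y, f y ∂(S.step N k ξ)) * (1 - avg (fun x => (S.g k x : ℝ)) ξ) := by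
  have h := avg_mul_integral_stepKernel (S.g k) (S.measurable_g k) (S.K (k + 1)) hf ξ
  change _ = avg (S.G k (kernelOp (S.K (k + 1)) f)) ξ at h
  rw [← h]
  change _ = (∫ y, f y ∂(stepKernel _ _ _ ξ)) * _
  rw [step]
  ring

/-! ### Mean square errors of order `1 / N` -/

/-- The mean square error of the particle averages at stage `k` is of order `1 / N`. -/
def MeanSquareRate (k : ℕ) : Prop :=
  ∀ (f : E → ℝ) (C : ℝ), IsBM f C → ∃ A : ℝ, 0 ≤ A ∧ ∀ (N : ℕ) [NeZero N],
    ∫ ξ, (avg f ξ - ∫ x, f x ∂(S.μ k)) ^ 2 ∂(S.particleLaw N k) ≤ A / N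

variable {S}

/-- The conditional mean m equals avg (G K f) + m (1 - avg g) with |m| ≤ C, and the two averages
have limits 0 and 1 with a known rate. -/
lemma MeanSquareRate.step {k : ℕ} (h : S.MeanSquareRate k) (hk : k < n) {f : E → ℝ} {C : ℝ}
    (hf : IsBM f C) (hf0 : ∫ x, f x ∂(S.μ (k + 1)) = 0) : ∃ A : ℝ, 0 ≤ A ∧
    ∀ (N : ℕ) [NeZero N], ∫ ξ, (∫ y, f y ∂(S.step N k ξ)) ^ 2 ∂(S.particleLaw N k) ≤ A / N := by
  obtain ⟨D, hg⟩ := S.exists_isBM_g hk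
  obtain ⟨D', hG⟩ := S.exists_isBM_G_kernelOp hk hf
  obtain ⟨A₁, hA₁, h₁⟩ := h _ _ hg
  obtain ⟨A₂, hA₂, h₂⟩ := h _ _ hG
  rw [S.integral_g hk] at h₁
  rw [S.integral_G_kernelOp hk hf, hf0] at h₂
  refine ⟨2 * C ^ 2 * A₁ + 2 * A₂, by positivity, fun N _ => ?_⟩
  have i₁ := (((hg.avg (N := N)).sub_const 1).sq.integrable (S.particleLaw N k)).const_mul
    (2 * C ^ 2)
  have i₂ := (((hG.avg (N := N)).sub_const 0).sq.integrable (S.particleLaw N k)).const_mul 2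
  calc ∫ ξ, (∫ y, f y ∂(S.step N k ξ)) ^ 2 ∂(S.particleLaw N k)
      ≤ ∫ ξ, (2 * C ^ 2 * (avg (fun x => (S.g k x : ℝ)) ξ - 1) ^ 2
        + 2 * (avg (S.G k (kernelOp (S.K (k + 1)) f)) ξ - 0) ^ 2) ∂(S.particleLaw N k) := by
        refine integral_mono ((hf.integral_kernel (S.step N k)).sq.integrable _) (i₁.add i₂) ?_
        intro ξ
        have e := S.integral_step (k := k) hf ξ
        have b := sq_le_sq' (abs_le.1 (hf.abs_integral_le (S.step N k ξ))).1
          (abs_le.1 (hf.abs_integral_le (S.step N k ξ))).2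
        dsimp only [Pi.add_apply]
        generalize ∫ y, f y ∂(S.step N k ξ) = m at e b ⊢
        generalize avg (S.G k (kernelOp (S.K (k + 1)) f)) ξ = a at e ⊢
        generalize avg (fun x => (S.g k x : ℝ)) ξ = c at e ⊢
        have hm : m = a + m * (1 - c) := by linarith
        have h1 : m ^ 2 ≤ 2 * a ^ 2 + 2 * (m * (1 - c)) ^ 2 := by
          have h2 : m ^ 2 = (a + m * (1 - c)) ^ 2 := by rw [← hm]
          rw [h2]
          linarith [sq_nonneg (a - m * (1 - c))]
        have h2 : m ^ 2 * (1 - c) ^ 2 ≤ C ^ 2 * (1 - c) ^ 2 := by gcongr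
        nlinarith
    _ ≤ 2 * C ^ 2 * (A₁ / N) + 2 * (A₂ / N) := by
        rw [integral_add i₁ i₂, integral_const_mul, integral_const_mul]
        gcongr
        · exact h₁ N
        · exact h₂ N
    _ = _ := by ring

variable (S) in
lemma meanSquareRate {k : ℕ} (hk : k ≤ n) : S.MeanSquareRate k := by
  induction k with
  | zero => exact fun f C hf => ⟨C ^ 2, sq_nonneg C, fun N _ => integral_avg_sub_sq_le (S.μ 0) hf⟩
  | succ k ih =>
    intro f C hf
    set c := ∫ x, f x ∂(S.μ (k + 1))
    have hf' := hf.sub_const c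
    have hf0 : ∫ x, (f x - c) ∂(S.μ (k + 1)) = 0 := by
      rw [integral_sub (hf.integrable _) (integrable_const _)]
      simp [c]
    obtain ⟨A, hA, h⟩ := (ih (Nat.le_of_succ_le hk)).step hk hf' hf0
    set D := C + |c|
    refine ⟨2 * D ^ 2 + 2 * A, by positivity, fun N _ => ?_⟩
    simp_rw [← avg_sub_const]
    have hb := hf'.avg (N := N)
    rw [S.integral_particleLaw_succ N k (hb.sq.integrable _)]
    have i₂ := ((hf'.integral_kernel (S.step N k)).sq.integrable (S.particleLaw N k)).const_mul 2
    -- Given ξ, the error splits into i.i.d. sampling noise and the conditional mean handled by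
    -- `MeanSquareRate.step`.
    calc _ ≤ ∫ ξ, (2 * D ^ 2 / N + 2 * (∫ y, (f y - c) ∂(S.step N k ξ)) ^ 2)
          ∂(S.particleLaw N k) := by
          refine integral_mono_of_nonneg (ae_of_all _ fun ξ => integral_nonneg fun _ => sq_nonneg _)
            ((integrable_const _).add i₂) (ae_of_all _ fun ξ => ?_)
          set m := ∫ y, (f y - c) ∂(S.step N k ξ)
          have h1 := integral_avg_sub_sq_le (N := N) (S.step N k ξ) hf'
          have i1 := ((hb.sub_const m).sq.integrable
            (Measure.pi fun _ : Fin N => S.step N k ξ)).const_mul 2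
          calc _ ≤ ∫ ζ, (2 * (avg (fun x => f x - c) ζ - m) ^ 2 + 2 * m ^ 2)
                ∂(Measure.pi fun _ : Fin N => S.step N k ξ) := by
                refine integral_mono (hb.sq.integrable _) (i1.add (integrable_const _)) fun ζ => ?_
                dsimp only [Pi.add_apply]
                nlinarith [sq_nonneg (avg (fun x => f x - c) ζ - 2 * m)]
            _ ≤ 2 * (D ^ 2 / N) + 2 * m ^ 2 := by
                rw [integral_add i1 (integrable_const _), integral_const_mul]
                simp only [integral_const, probReal_univ, one_smul]
                gcongr
            _ = _ := by ring
      _ ≤ 2 * D ^ 2 / N + 2 * (A / N) := by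
          rw [integral_add (integrable_const _) i₂, integral_const_mul]
          simp only [integral_const, probReal_univ, one_smul]
          gcongr
          exact h N
      _ = _ := by ring

/-! ### Convergence of the characteristic functions -/

variable (S) in
/-- The asymptotic variance at stage `k`. -/
def asymVar (k : ℕ) (f : E → ℝ) : ℝ :=
  ∑ j ∈ Finset.range (k + 1), ∫ x, (S.Q j (k - j) f x) ^ 2 ∂(S.μ j)

variable (S) in
-- The variance recursion matching the induction on characteristic functions: fresh noise at stage k
-- + 1, plus the noise inherited through G K f.
lemma asymVar_succ (k : ℕ) (f : E → ℝ) :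
    S.asymVar (k + 1) f = S.asymVar k (S.G k (kernelOp (S.K (k + 1)) f))
      + ∫ x, f x ^ 2 ∂(S.μ (k + 1)) := by
  rw [asymVar, Finset.sum_range_succ, asymVar]
  congr 1
  · refine Finset.sum_congr rfl fun j hj => ?_
    have hjk : j ≤ k := Nat.lt_succ_iff.1 (Finset.mem_range.1 hj)
    rw [Nat.succ_sub hjk, Nat.succ_eq_add_one, Q_succ_right, Nat.add_sub_cancel' hjk]
  · simp [Q]

lemma norm_exp_mul_I_sub_le (a b : ℝ) :
    ‖Complex.exp (a * Complex.I) - Complex.exp (b * Complex.I)‖ ≤ |a - b| := by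
  have h : Complex.exp (a * Complex.I) - Complex.exp (b * Complex.I)
      = Complex.exp (b * Complex.I) * (Complex.exp (Complex.I * (a - b : ℝ)) - 1) := by
    rw [mul_sub, ← Complex.exp_add]
    congr 2
    · push_cast; ring
    · ring
  rw [h, norm_mul, Complex.norm_exp_ofReal_mul_I, one_mul]
  exact Real.norm_exp_I_mul_ofReal_sub_one_le

lemma integrable_exp_mul_I {X : Type*} [MeasurableSpace X] (ν : Measure X) [IsFiniteMeasure ν]
    {f : X → ℝ} (hf : Measurable f) (t r : ℝ) :
    Integrable (fun x => Complex.exp (t * (r * f x : ℝ) * Complex.I)) ν := by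
  refine Integrable.of_bound (Measurable.aestronglyMeasurable (by fun_prop)) 1
    (ae_of_all _ fun x => ?_)
  have := Complex.norm_exp_ofReal_mul_I (t * (r * f x))
  push_cast at this ⊢
  exact this.le

/-- The characteristic functions of the errors at stage `k` converge with rate `1 / √N`. -/
lemma charFun_rate (S : SMCSampler E n) {k : ℕ} (hk : k ≤ n) (f : E → ℝ) (C : ℝ) (hf : IsBM f C)
    (hf0 : ∫ x, f x ∂(S.μ k) = 0) (t : ℝ) : ∃ A : ℝ, 0 ≤ A ∧ ∀ (N : ℕ) [NeZero N],
    ‖∫ ξ, Complex.exp (t * (√N * avg f ξ : ℝ) * Complex.I) ∂(S.particleLaw N k)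
      - Complex.exp (-(t ^ 2 * S.asymVar k f / 2 : ℝ))‖ ≤ A / √N := by
  -- The inductive step applies the hypothesis to G K f, so f must vary.
  induction k generalizing f C with
  | zero =>
    have : Nonempty E := (S.μ 0).nonempty_of_neZero
    obtain ⟨A, hA, h⟩ := exists_norm_charFun_pow_sub_le (E := E) C hf.nonneg t
    refine ⟨A, hA, fun N _ => ?_⟩
    have h' := h N (S.μ 0) f hf (∫ x, f x ^ 2 ∂(S.μ 0)) (hf.sq.abs_integral_le _)
      (integral_nonneg fun _ => sq_nonneg _)
    rw [hf0, ← integral_pi_exp_avg] at h'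
    -- The initial particles have exact mean 0 and second moment v; only the 1/√N term survives.
    simp only [sub_self, abs_zero] at h'
    rw [particleLaw]
    convert h' using 1
    · congr 3
      simp [asymVar, Q]
    · ring
  | succ k ih =>
    have hkn : k ≤ n := Nat.le_of_succ_le hk
    have : Nonempty E := (S.μ 0).nonempty_of_neZero
    set h := S.G k (kernelOp (S.K (k + 1)) f)
    set v := ∫ x, f x ^ 2 ∂(S.μ (k + 1))
    have hv0 : 0 ≤ v := integral_nonneg fun _ => sq_nonneg _
    obtain ⟨D, hg⟩ := S.exists_isBM_g hk
    obtain ⟨D', hG⟩ := S.exists_isBM_G_kernelOp hk hf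
    have hms := S.meanSquareRate hkn
    -- Centering f² makes `MeanSquareRate.step` control the conditional second moment as well.
    have hf2 := hf.sq.sub_const v
    have hf20 : ∫ x, (f x ^ 2 - v) ∂(S.μ (k + 1)) = 0 := by
      rw [integral_sub (hf.sq.integrable _) (integrable_const _)]
      simp [v]
    obtain ⟨A₁, hA₁, h₁⟩ := hms.step hk hf hf0
    obtain ⟨A₂, hA₂, h₂⟩ := hms.step hk hf2 hf20
    obtain ⟨A₃, hA₃, h₃⟩ := hms _ _ hg
    rw [S.integral_g hk] at h₃
    obtain ⟨A₄, hA₄, h₄⟩ := ih hkn h D' hG ((S.integral_G_kernelOp hk hf).trans hf0)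
    obtain ⟨A₅, hA₅, h₅⟩ := exists_norm_charFun_pow_sub_le (E := E) C hf.nonneg t
    refine ⟨A₅ * (1 + A₁ + (A₂ + 1) / 2) + |t| * ((A₁ + A₃) / 2) + A₄, by positivity, fun N _ => ?_⟩
    have hN1 : (1 : ℝ) ≤ N := by exact_mod_cast Nat.one_le_iff_ne_zero.2 (NeZero.ne N)
    have hr1 : 1 ≤ √(N : ℝ) := Real.one_le_sqrt.2 hN1
    have hrr : (N : ℝ) = √(N : ℝ) ^ 2 := (Real.sq_sqrt (by linarith)).symm
    have hb := hf.avg (N := N)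
    have hGb := hG.avg (N := N)
    have hgb := hg.avg (N := N)
    have hstep := hf.integral_kernel (S.step N k)
    have hstep2 := hf.sq.integral_kernel (S.step N k)
    have h₁' := h₁ N
    have h₂' := h₂ N
    have h₃' := h₃ N
    have h₄' := h₄ N
    have h₅' := fun ξ : Fin N → E =>
      h₅ N (S.step N k ξ) f hf v (hf.sq.abs_integral_le _) hv0
    rw [S.integral_particleLaw_succ N k (integrable_exp_mul_I _ hb.meas t √N)]
    have iP := integrable_exp_mul_I (S.particleLaw N k) hstep.meas t √N
    have iG := integrable_exp_mul_I (S.particleLaw N k) hGb.meas t √N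
    simp_rw [integral_pi_exp_avg]
    set P := S.particleLaw N k
    rw [hrr] at h₁' h₂' h₃'
    generalize √(N : ℝ) = r at *
    have hr0 : 0 < r := by linarith
    set m : (Fin N → E) → ℝ := fun ξ => ∫ x, f x ∂(S.step N k ξ) with hm
    set w : (Fin N → E) → ℝ := fun ξ => ∫ x, f x ^ 2 ∂(S.step N k ξ)
    have h₂'' : ∫ ξ, (w ξ - v) ^ 2 ∂P ≤ A₂ / r ^ 2 := by
      refine le_of_eq_of_le ?_ h₂'
      congr 1
      funext ξ
      rw [integral_sub (hf.sq.integrable _) (integrable_const _)]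
      simp [w]
    set z : (Fin N → E) → ℂ := fun ξ =>
      (∫ x, Complex.exp ((t / r : ℝ) * f x * Complex.I) ∂(S.step N k ξ)) ^ N with hz
    set a : ℂ := Complex.exp (-(t ^ 2 * v / 2 : ℝ)) with ha
    have ha1 : ‖a‖ ≤ 1 := by
      rw [ha, ← Complex.ofReal_neg, Complex.norm_exp_ofReal, Real.exp_le_one_iff]
      have : 0 ≤ t ^ 2 * v / 2 := by positivity
      linarith
    have iz : Integrable z P := by
      refine Integrable.of_bound ?_ 1 (ae_of_all _ fun ξ => ?_)
      · have hfm := hf.meas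
        have : StronglyMeasurable fun x => Complex.exp ((t / r : ℝ) * f x * Complex.I) :=
          Measurable.stronglyMeasurable (by fun_prop)
        exact ((this.integral_kernel (κ := S.step N k)).pow N).aestronglyMeasurable
      · have h1 : ∀ x, ‖Complex.exp ((t / r : ℝ) * f x * Complex.I)‖ ≤ 1 := fun x => by
          have := Complex.norm_exp_ofReal_mul_I (t / r * f x)
          rw [Complex.ofReal_mul] at this
          exact this.le
        have h2 := norm_integral_le_of_norm_le_const (μ := S.step N k ξ) (ae_of_all _ h1)
        rw [probReal_univ, mul_one] at h2
        rw [hz, norm_pow]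
        exact pow_le_one₀ (norm_nonneg _) h2
    have im2 : Integrable (fun ξ => m ξ ^ 2) P := hstep.sq.integrable _
    have iw : Integrable (fun ξ => (w ξ - v) ^ 2) P := (hstep2.sub_const v).sq.integrable _
    have iwa : Integrable (fun ξ => |w ξ - v|) P := ((hstep2.sub_const v).integrable P).abs
    have ig : Integrable (fun ξ => (avg (fun x => (S.g k x : ℝ)) ξ - 1) ^ 2) P :=
      (hgb.sub_const 1).sq.integrable _
    have d1 : ‖∫ ξ, z ξ ∂P - (∫ ξ, Complex.exp (t * (r * m ξ : ℝ) * Complex.I) ∂P) * a‖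
        ≤ A₅ * (1 + A₁ + (A₂ + 1) / 2) / r := by
      rw [← integral_mul_const, ← integral_sub iz (iP.mul_const a)]
      -- Young's inequality u ≤ (r / 2) u² + 1 / (2 r) turns the mean square rate 1/r² into an L¹
      -- rate 1/r.
      have hEabs : ∫ ξ, |w ξ - v| ∂P ≤ (A₂ + 1) / 2 / r := by
        calc _ ≤ ∫ ξ, (r / 2 * (w ξ - v) ^ 2 + 1 / (2 * r)) ∂P := by
              refine integral_mono iwa ((iw.const_mul _).add (integrable_const _)) fun ξ => ?_
              dsimp only [Pi.add_apply]
              rw [← sq_abs (w ξ - v)]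
              generalize |w ξ - v| = u
              have : r / 2 * u ^ 2 + 1 / (2 * r) - u = (r * u - 1) ^ 2 / (2 * r) := by
                field_simp; ring
              have : 0 ≤ (r * u - 1) ^ 2 / (2 * r) := by positivity
              linarith
          _ ≤ r / 2 * (A₂ / r ^ 2) + 1 / (2 * r) := by
              rw [integral_add (iw.const_mul _) (integrable_const _), integral_const_mul]
              simp only [integral_const, probReal_univ, one_smul]
              gcongr
          _ = _ := by field_simp
      have hrle : A₁ / r ^ 2 ≤ A₁ / r := by
        gcongr
        nlinarith
      have i0 : Integrable (fun ξ => 1 / r + m ξ ^ 2) P := (integrable_const _).add im2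
      have ib : Integrable (fun ξ => 1 / r + m ξ ^ 2 + |w ξ - v|) P := i0.add iwa
      calc _ ≤ ∫ ξ, A₅ * (1 / r + m ξ ^ 2 + |w ξ - v|) ∂P := by
            refine norm_integral_le_of_norm_le (ib.const_mul _) (ae_of_all _ fun ξ => ?_)
            refine le_of_eq_of_le ?_ (h₅' ξ)
            rw [ha, ← Complex.exp_add]
            congr 3
            push_cast
            ring
        _ ≤ A₅ * (1 / r + A₁ / r + (A₂ + 1) / 2 / r) := by
            rw [integral_const_mul, integral_add i0 iwa,
              integral_add (integrable_const _) im2]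
            simp only [integral_const, probReal_univ, one_smul]
            gcongr
            exact h₁'.trans hrle
        _ = _ := by ring
    have d2 : ‖∫ ξ, Complex.exp (t * (r * m ξ : ℝ) * Complex.I) ∂P
        - ∫ ξ, Complex.exp (t * (r * avg h ξ : ℝ) * Complex.I) ∂P‖
        ≤ |t| * ((A₁ + A₃) / 2) / r := by
      rw [← integral_sub iP iG]
      -- The phases differ by t r m (1 - avg g); the product is split into squares of mean order
      -- 1/r², which beats the factor r.
      calc _ ≤ ∫ ξ, |t| * r / 2 * (m ξ ^ 2 + (avg (fun x => (S.g k x : ℝ)) ξ - 1) ^ 2) ∂P := by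
            refine norm_integral_le_of_norm_le ((im2.add ig).const_mul _) (ae_of_all _ fun ξ => ?_)
            have e := S.integral_step (k := k) hf ξ
            have b := norm_exp_mul_I_sub_le (t * (r * m ξ)) (t * (r * avg h ξ))
            rw [Complex.ofReal_mul t, Complex.ofReal_mul t] at b
            refine b.trans ?_
            have e2 : t * (r * m ξ) - t * (r * avg h ξ)
                = t * r * (m ξ * (1 - avg (fun x => (S.g k x : ℝ)) ξ)) := by
              rw [hm, ← e]; ring
            rw [e2, abs_mul, abs_mul, abs_of_pos hr0, mul_div_assoc, mul_assoc, mul_assoc,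
              div_mul_eq_mul_div, mul_div_assoc]
            gcongr
            rw [abs_mul, ← sq_abs (m ξ), ← sq_abs (_ - 1), abs_sub_comm _ 1]
            nlinarith [sq_nonneg (|m ξ| - |1 - avg (fun x => (S.g k x : ℝ)) ξ|)]
        _ ≤ |t| * r / 2 * (A₁ / r ^ 2 + A₃ / r ^ 2) := by
            rw [integral_const_mul, integral_add im2 ig]
            gcongr
        _ = _ := by field_simp
    have hsplit : Complex.exp (-(t ^ 2 * S.asymVar (k + 1) f / 2 : ℝ))
        = Complex.exp (-(t ^ 2 * S.asymVar k h / 2 : ℝ)) * a := by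
      rw [S.asymVar_succ, ha, ← Complex.exp_add]
      congr 1
      push_cast
      ring
    rw [hsplit]
    -- Three replacements: Gaussian fresh noise, linearized conditional mean, inductive limit; ‖a‖ ≤
    -- 1 preserves the bounds.
    have htri : ∀ p q s u : ℂ, p - u * a = (p - q * a) + (q - s) * a + (s - u) * a := by
      intros; ring
    rw [htri _ (∫ ξ, Complex.exp (t * (r * m ξ : ℝ) * Complex.I) ∂P)
      (∫ ξ, Complex.exp (t * (r * avg h ξ : ℝ) * Complex.I) ∂P)]
    have hmul : ∀ {p : ℂ} {b : ℝ}, ‖p‖ ≤ b → ‖p * a‖ ≤ b := fun {p b} hp => by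
      rw [norm_mul]
      exact (mul_le_of_le_one_right (norm_nonneg _) ha1).trans hp
    rw [add_div, add_div]
    exact (norm_add_le _ _).trans (add_le_add ((norm_add_le _ _).trans
      (add_le_add d1 (hmul d2))) (hmul h₄'))

end

end SMCSampler

namespace SMCSampler

noncomputable section

variable {E : Type*} [MeasurableSpace E] {n : ℕ} (S : SMCSampler E n)

/-! ### The central limit theorem -/

lemma isBM_centered {φ : E → ℝ} {C : ℝ} (hφ : IsBM φ C) : ∃ D, IsBM (S.centered φ) D :=
  ⟨_, hφ.sub_const _⟩

lemma integral_centered {φ : E → ℝ} {C : ℝ} (hφ : IsBM φ C) :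
    ∫ x, S.centered φ x ∂(S.μ n) = 0 := by
  simp only [centered]
  rw [integral_sub (hφ.integrable _) (integrable_const _)]
  simp

lemma scaledError_eq (φ : E → ℝ) (N : ℕ) [NeZero N] (ξ : Fin N → E) :
    S.scaledError φ N ξ = √N * avg (S.centered φ) ξ := by
  unfold centered
  rw [avg_sub_const, scaledError, avg, one_div]

lemma measurable_scaledError {φ : E → ℝ} (hφ : Measurable φ) (N : ℕ) :
    Measurable (S.scaledError φ N) := by
  unfold scaledError
  have : Measurable fun ξ : Fin N → E => ∑ i, φ (ξ i) :=
    Finset.measurable_fun_sum _ fun i _ => hφ.comp (measurable_pi_apply i)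
  fun_prop

theorem tendstoInDistribution_scaledError {φ : E → ℝ} {C : ℝ} (hφ : IsBM φ C) :
    TendstoInDistribution (S.scaledError φ) atTop (id : ℝ → ℝ) (fun N => S.particleLaw N n)
      (gaussianReal 0 (∑ k ∈ Finset.range (n + 1), S.V k (S.centered φ)).toNNReal) where
  forall_aemeasurable N := (S.measurable_scaledError hφ.meas N).aemeasurable
  tendsto := by
    refine ProbabilityMeasure.tendsto_iff_tendsto_charFun.2 fun t => ?_
    obtain ⟨D, hD⟩ := S.isBM_centered hφ
    obtain ⟨A, hA, h⟩ := S.charFun_rate le_rfl _ D hD (S.integral_centered hφ) t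
    simp only [ProbabilityMeasure.coe_mk, Measure.map_id]
    have hV : 0 ≤ ∑ k ∈ Finset.range (n + 1), S.V k (S.centered φ) :=
      Finset.sum_nonneg fun k _ => integral_nonneg fun _ => sq_nonneg _
    have hlim : charFun (gaussianReal 0
        (∑ k ∈ Finset.range (n + 1), S.V k (S.centered φ)).toNNReal) t
        = Complex.exp (-(t ^ 2 * S.asymVar n (S.centered φ) / 2 : ℝ)) := by
      rw [charFun_gaussianReal, Real.coe_toNNReal _ hV]
      congr 1
      simp only [asymVar, V]
      push_cast
      ring
    rw [hlim, tendsto_iff_norm_sub_tendsto_zero]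
    have hA0 : Tendsto (fun N : ℕ => A / √(N : ℝ)) atTop (nhds 0) :=
      tendsto_const_nhds.div_atTop (Real.tendsto_sqrt_atTop.comp tendsto_natCast_atTop_atTop)
    refine tendsto_of_tendsto_of_tendsto_of_le_of_le' tendsto_const_nhds hA0
      (Eventually.of_forall fun _ => norm_nonneg _) ?_
    filter_upwards [eventually_ge_atTop 1] with N hN
    have : NeZero N := ⟨Nat.one_le_iff_ne_zero.1 hN⟩
    rw [charFun_apply_real, integral_map (S.measurable_scaledError hφ.meas N).aemeasurable
      (Measurable.aestronglyMeasurable (by fun_prop))]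
    simp_rw [scaledError_eq]
    exact h N

/-! ### The variance bound -/

variable {S}

lemma supNorm_nonneg {X : Type*} (f : X → ℝ) : 0 ≤ supNorm f :=
  Real.iSup_nonneg fun _ => abs_nonneg _

lemma abs_le_supNorm {X : Type*} {f : X → ℝ} {C : ℝ} (hf : ∀ x, |f x| ≤ C) (x : X) :
    |f x| ≤ supNorm f :=
  le_ciSup (f := fun x => |f x|) ⟨C, by rintro _ ⟨y, rfl⟩; exact hf y⟩ x

lemma g_le_Γg {k : ℕ} (hk : k < n) (x : E) : (S.g k x : ℝ) ≤ S.Γg := by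
  obtain ⟨C, hC⟩ := S.exists_isBM_g hk
  refine (le_abs_self _).trans ((abs_le_supNorm hC.bound x).trans ?_)
  exact le_ciSup (f := fun k : Fin n => supNorm fun x => (S.g k x : ℝ))
    (Set.finite_range _).bddAbove ⟨k, hk⟩

lemma Γg_nonneg : 0 ≤ S.Γg := Real.iSup_nonneg fun _ => supNorm_nonneg _

/-- The density has integral 1. Positivity lets g / Γ_g serve as a test function of norm at most 1.
-/
lemma Γg_pos {k : ℕ} (hk : k < n) : 0 < S.Γg := by
  obtain ⟨C, hC⟩ := S.exists_isBM_g hk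
  have h := integral_mono (hC.integrable (S.μ k)) (integrable_const S.Γg) fun x => g_le_Γg hk x
  rw [S.integral_g hk] at h
  simp only [integral_const, probReal_univ, one_smul] at h
  linarith

/-- Weighted Cauchy–Schwarz, from the discriminant of the nonnegative quadratic c ↦ ∫ g (c - u)². -/
lemma sq_integral_mul_le (ν : Measure E) [IsProbabilityMeasure ν] {g u : E → ℝ} {C D : ℝ}
    (hg : IsBM g C) (hg0 : ∀ x, 0 ≤ g x) (hu : IsBM u D) :
    (∫ x, g x * u x ∂ν) ^ 2 ≤ (∫ x, g x ∂ν) * ∫ x, g x * u x ^ 2 ∂ν := by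
  have h : ∀ c : ℝ, 0 ≤ (∫ x, g x ∂ν) * (c * c) + (-2 * ∫ x, g x * u x ∂ν) * c
      + ∫ x, g x * u x ^ 2 ∂ν := by
    intro c
    have i0 := (hg.integrable ν).mul_const (c * c)
    have i1 := (((hg.mul hu).integrable ν).const_mul (-2)).mul_const c
    have i2 := (hg.mul hu.sq).integrable ν
    have i01 : Integrable (fun x => g x * (c * c) + -2 * (g x * u x) * c) ν := i0.add i1
    rw [← integral_mul_const, ← integral_const_mul, ← integral_mul_const, ← integral_add i0 i1,
      ← integral_add i01 i2]
    refine integral_nonneg fun x => ?_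
    have : g x * (c * c) + -2 * (g x * u x) * c + g x * u x ^ 2 = g x * (c - u x) ^ 2 := by ring
    dsimp only [Pi.zero_apply]
    rw [this]
    exact mul_nonneg (hg0 x) (sq_nonneg _)
  have := discrim_le_zero h
  rw [discrim] at this
  linarith

/-- The mean density over a mode is its growth ratio. For a null mode both sides are 0 by
convention. -/
lemma integral_g_cond {k : ℕ} (hk : k < n) {A : Set E} (hA : MeasurableSet A) :
    ∫ x, (S.g k x : ℝ) ∂(ProbabilityTheory.cond (S.μ k) A)
      = (S.μ (k + 1)).real A / (S.μ k).real A := by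
  have h : ∫ x in A, (S.g k x : ℝ) ∂(S.μ k) = (S.μ (k + 1)).real A := by
    have h1 := S.integral_succ hk (A.indicator fun _ => (1 : ℝ))
    rw [integral_indicator hA, setIntegral_const, smul_eq_mul, mul_one] at h1
    rw [h1, ← integral_indicator hA]
    congr 1
    funext x
    by_cases hx : x ∈ A <;> simp [hx]
  rw [ProbabilityTheory.cond, integral_smul_measure, h, ENNReal.toReal_inv, smul_eq_mul,
    div_eq_inv_mul, Measure.real, Measure.real]

/-! ### Bounding K g through the metastable approximation. -/

section Metastable

variable {k m : ℕ} {F : Fin m → Set E} {α : Fin m → E → ℝ}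

lemma abs_integral_cond_le (A : Set E) {f : E → ℝ} (hf : ∀ x, |f x| ≤ 1) :
    |∫ y, f y ∂(ProbabilityTheory.cond (S.μ k) A)| ≤ 1 := by
  have hf' : ∀ x, ‖f x‖ ≤ 1 := hf
  have h := norm_integral_le_of_norm_le_const (μ := ProbabilityTheory.cond (S.μ k) A)
    (ae_of_all _ hf')
  rw [one_mul] at h
  exact h.trans measureReal_le_one

lemma abs_metastableOp_le (hα0 : ∀ r x, 0 ≤ α r x) (hα1 : ∀ x, ∑ r, α r x ≤ 1)
    {f : E → ℝ} (hf : ∀ x, |f x| ≤ 1) (x : E) : |S.metastableOp k F α f x| ≤ 1 := by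
  refine (Finset.abs_sum_le_sum_abs _ _).trans (le_trans (Finset.sum_le_sum fun r _ => ?_) (hα1 x))
  rw [abs_mul, abs_of_nonneg (hα0 r x)]
  exact mul_le_of_le_one_right (hα0 r x) (abs_integral_cond_le _ hf)

lemma growth_nonneg : 0 ≤ S.growth k F :=
  Real.iSup_nonneg fun _ => div_nonneg measureReal_nonneg measureReal_nonneg

lemma metastableOp_g_le (hk : k < n) (hF : ∀ r, MeasurableSet (F r)) (hα0 : ∀ r x, 0 ≤ α r x)
    (hα1 : ∀ x, ∑ r, α r x ≤ 1) (x : E) :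
    S.metastableOp k F α (fun y => (S.g k y : ℝ)) x ≤ S.growth k F := by
  calc S.metastableOp k F α (fun y => (S.g k y : ℝ)) x ≤ ∑ r, α r x * S.growth k F := by
        refine Finset.sum_le_sum fun r _ => mul_le_mul_of_nonneg_left ?_ (hα0 r x)
        rw [integral_g_cond hk (hF r)]
        exact le_ciSup (f := fun r => (S.μ (k + 1)).real (F r) / (S.μ k).real (F r))
          (Set.finite_range _).bddAbove r
    _ ≤ _ := by
        rw [← Finset.sum_mul]
        exact mul_le_of_le_one_left growth_nonneg (hα1 x)

lemma kernelOp_sub_metastableOp_le (hα0 : ∀ r x, 0 ≤ α r x) (hα1 : ∀ x, ∑ r, α r x ≤ 1)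
    {f : E → ℝ} (hf : IsBM f 1) (x : E) :
    kernelOp (S.K k) f x - S.metastableOp k F α f x
      ≤ opSupNorm fun f x => kernelOp (S.K k) f x - S.metastableOp k F α f x := by
  -- The uniform bound 2 makes the suprema in `opSupNorm` genuine rather than default values.
  have hb : ∀ f : E → ℝ, IsBM f 1 → ∀ x,
      |kernelOp (S.K k) f x - S.metastableOp k F α f x| ≤ 2 := fun f hf x => by
    have h1 := (S.isBM_kernelOp k hf).bound x
    have h2 := abs_metastableOp_le (S := S) (k := k) (F := F) hα0 hα1 hf.bound x
    linarith [abs_sub (kernelOp (S.K k) f x) (S.metastableOp k F α f x)]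
  refine (le_abs_self _).trans ((abs_le_supNorm (hb f hf) x).trans ?_)
  refine le_csSup ⟨2, ?_⟩ ⟨f, hf.meas, hf.bound, rfl⟩
  rintro _ ⟨f', hm, hb', rfl⟩
  exact Real.iSup_le (hb f' ⟨hm, hb'⟩) zero_le_two

/-- The metastable part of K g is at most the growth constant; the remainder is the operator
difference tested on g / Γ_g, then rescaled. -/
lemma kernelOp_g_le (hk : k < n) (hF : ∀ r, MeasurableSet (F r)) (hα0 : ∀ r x, 0 ≤ α r x)
    (hα1 : ∀ x, ∑ r, α r x ≤ 1) (x : E) :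
    kernelOp (S.K k) (fun y => (S.g k y : ℝ)) x ≤ S.growth k F + S.Γg *
      opSupNorm fun f x => kernelOp (S.K k) f x - S.metastableOp k F α f x := by
  have hΓ := Γg_pos (S := S) hk
  have hf : IsBM (fun y => S.Γg⁻¹ * (S.g k y : ℝ)) 1 :=
    ⟨(S.measurable_g k).coe_nnreal_real.const_mul _, fun y => by
      rw [abs_of_nonneg (mul_nonneg (inv_nonneg.2 hΓ.le) (S.g k y).coe_nonneg),
        inv_mul_le_iff₀ hΓ, mul_one]
      exact g_le_Γg hk y⟩
  have h := kernelOp_sub_metastableOp_le (S := S) (k := k) (F := F) hα0 hα1 hf x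
  have hK : kernelOp (S.K k) (fun y => S.Γg⁻¹ * (S.g k y : ℝ)) x
      = S.Γg⁻¹ * kernelOp (S.K k) (fun y => (S.g k y : ℝ)) x := integral_const_mul _ _
  have hM : S.metastableOp k F α (fun y => S.Γg⁻¹ * (S.g k y : ℝ)) x
      = S.Γg⁻¹ * S.metastableOp k F α (fun y => (S.g k y : ℝ)) x := by
    simp only [metastableOp, integral_const_mul, Finset.mul_sum]
    exact Finset.sum_congr rfl fun _ _ => by ring
  rw [hK, hM, ← mul_sub, inv_mul_le_iff₀ hΓ] at h
  linarith [metastableOp_g_le (S := S) hk hF hα0 hα1 x]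

end Metastable

/-! ### L² recursion along the stages. -/

lemma exists_isBM_Q (k d : ℕ) (hkd : k + d ≤ n) {f : E → ℝ} {C : ℝ} (hf : IsBM f C) :
    ∃ D, IsBM (S.Q k d f) D := by
  induction d generalizing k with
  | zero => exact ⟨C, hf⟩
  | succ d ih =>
    obtain ⟨D, hD⟩ := ih (k + 1) (by omega)
    exact S.exists_isBM_G_kernelOp (by omega) hD

lemma integral_sq_G_le {k : ℕ} (hk : k < n) {u : E → ℝ} {C : ℝ} (hu : IsBM u C) :
    ∫ x, (S.G k u x) ^ 2 ∂(S.μ k) ≤ S.Γg * ∫ x, u x ^ 2 ∂(S.μ (k + 1)) := by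
  obtain ⟨D, hD⟩ := S.exists_isBM_g hk
  rw [S.integral_succ hk, ← integral_const_mul]
  refine integral_mono ((hD.mul hu).sq.integrable _) (((hD.mul hu.sq).integrable _).const_mul _)
    fun x => ?_
  have : (S.G k u x) ^ 2 = (S.g k x : ℝ) * ((S.g k x : ℝ) * u x ^ 2) := by rw [G]; ring
  dsimp only
  rw [this]
  exact mul_le_mul_of_nonneg_right (g_le_Γg hk x)
    (mul_nonneg (S.g k x).coe_nonneg (sq_nonneg _))

lemma integral_sq_kernelOp_le {k : ℕ} (hk : 1 ≤ k) (hkn : k ≤ n) {f : E → ℝ} {C : ℝ}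
    (hf : IsBM f C) :
    ∫ x, (kernelOp (S.K k) f x) ^ 2 ∂(S.μ k) ≤ ∫ x, f x ^ 2 ∂(S.μ k) := by
  rw [← S.integral_kernelOp hk hkn hf.sq]
  refine integral_mono ((S.isBM_kernelOp k hf).sq.integrable _)
    ((S.isBM_kernelOp k hf.sq).integrable _) fun x => ?_
  have h := sq_integral_mul_le (S.K k x) (g := fun _ => 1) (C := 1)
    ⟨measurable_const, fun _ => by simp⟩ (fun _ => zero_le_one) hf
  simp only [one_mul, integral_const, probReal_univ, one_smul] at h
  exact h

/-- Cauchy–Schwarz under K(x, ·) leaves one factor K g, bounded by B; the other, K (g u²),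
integrates exactly to the second moment at the next stage. -/
lemma integral_sq_kernelOp_G_le {k : ℕ} (hk : 1 ≤ k) (hkn : k < n) {B : ℝ}
    (hB : ∀ x, kernelOp (S.K k) (fun y => (S.g k y : ℝ)) x ≤ B) {u : E → ℝ} {C : ℝ}
    (hu : IsBM u C) :
    ∫ x, (kernelOp (S.K k) (S.G k u) x) ^ 2 ∂(S.μ k) ≤ B * ∫ x, u x ^ 2 ∂(S.μ (k + 1)) := by
  obtain ⟨D, hD⟩ := S.exists_isBM_g hkn
  have hgu := hD.mul hu.sq
  rw [S.integral_succ hkn, ← S.integral_kernelOp hk hkn.le hgu, ← integral_const_mul]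
  refine integral_mono ((S.isBM_kernelOp k (hD.mul hu)).sq.integrable _)
    (((S.isBM_kernelOp k hgu).integrable _).const_mul _) fun x => ?_
  refine (sq_integral_mul_le (S.K k x) hD (fun y => (S.g k y).coe_nonneg) hu).trans ?_
  exact mul_le_mul_of_nonneg_right (hB x)
    (integral_nonneg fun y => mul_nonneg (S.g k y).coe_nonneg (sq_nonneg _))

theorem V_le {B : ℕ → ℝ}
    (hB : ∀ k, 1 ≤ k → k < n → ∀ x, kernelOp (S.K k) (fun y => (S.g k y : ℝ)) x ≤ B k)
    {f : E → ℝ} {C : ℝ} (hf : IsBM f C) {k : ℕ} (hk : k < n) :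
    S.V k f ≤ S.Γg * (∏ j ∈ Finset.Ico (k + 1) n, B j) * ∫ x, f x ^ 2 ∂(S.μ n) := by
  have : Nonempty E := (S.μ 0).nonempty_of_neZero
  -- Grouping each G with the kernel preceding it leaves the outermost G alone, whence the single
  -- factor Γ_g.
  have hW : ∀ d j, 1 ≤ j → j + d = n → ∫ x, (kernelOp (S.K j) (S.Q j d f) x) ^ 2 ∂(S.μ j)
      ≤ (∏ i ∈ Finset.Ico j n, B i) * ∫ x, f x ^ 2 ∂(S.μ n) := by
    intro d
    induction d with
    | zero =>
      rintro j hj rfl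
      simpa [Q] using integral_sq_kernelOp_le hj le_rfl hf
    | succ d ih =>
      intro j hj hjn
      obtain ⟨D, hD⟩ := exists_isBM_Q (S := S) (j + 1) d (by omega) hf
      have hlt : j < n := by omega
      have hB0 : 0 ≤ B j :=
        le_trans (integral_nonneg fun y => (S.g j y).coe_nonneg)
          (hB j hj hlt (Classical.arbitrary E))
      rw [Finset.prod_eq_prod_Ico_succ_bot hlt, mul_assoc]
      exact (integral_sq_kernelOp_G_le hj hlt (hB j hj hlt) (S.isBM_kernelOp (j + 1) hD)).trans
        (mul_le_mul_of_nonneg_left (ih (j + 1) (by omega) (by omega)) hB0)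
  obtain ⟨d, rfl⟩ : ∃ d, n = k + 1 + d := ⟨n - (k + 1), by omega⟩
  obtain ⟨D, hD⟩ := exists_isBM_Q (S := S) (k + 1) d le_rfl hf
  rw [V, show k + 1 + d - k = d + 1 by omega, Q, mul_assoc]
  exact (integral_sq_G_le hk (S.isBM_kernelOp (k + 1) hD)).trans
    (mul_le_mul_of_nonneg_left (hW d (k + 1) (by omega) rfl) Γg_nonneg)

lemma integral_sq_le_supNorm_sq {φ : E → ℝ} {C : ℝ} (hφ : IsBM φ C) :
    ∫ x, φ x ^ 2 ∂(S.μ n) ≤ supNorm φ ^ 2 :=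
  (le_abs_self _).trans
    ((⟨hφ.meas, abs_le_supNorm hφ.bound⟩ : IsBM φ (supNorm φ)).sq.abs_integral_le _)

lemma integral_centered_sq_le {φ : E → ℝ} {C : ℝ} (hφ : IsBM φ C) :
    ∫ x, S.centered φ x ^ 2 ∂(S.μ n) ≤ ∫ x, φ x ^ 2 ∂(S.μ n) := by
  have h := variance_le_expectation_sq (μ := S.μ n) hφ.meas.aestronglyMeasurable
  rw [variance_eq_integral hφ.meas.aemeasurable] at h
  exact h

end

end SMCSampler

theorem mainTheorem2 {E : Type*} [TopologicalSpace E] [PolishSpace E] [MeasurableSpace E]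
    [BorelSpace E] {n : ℕ} (S : SMCSampler E n)
    (m : ℕ → ℕ) (F : (k : ℕ) → Fin (m k) → Set E)
    (hF_meas : ∀ k, 1 ≤ k → k < n → ∀ r, MeasurableSet (F k r))
    (hF_disj : ∀ k, 1 ≤ k → k < n → Pairwise fun r s => Disjoint (F k r) (F k s))
    (hF_cover : ∀ k, 1 ≤ k → k < n → ⋃ r, F k r = Set.univ)
    (α : (k : ℕ) → Fin (m k) → E → ℝ)
    (hα_nonneg : ∀ k, 1 ≤ k → k < n → ∀ r x, 0 ≤ α k r x)
    (hα_sum : ∀ k, 1 ≤ k → k < n → ∀ x, ∑ r, α k r x ≤ 1)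
    (φ : E → ℝ) (hφ_meas : Measurable φ) (hφ_bdd : ∃ C : ℝ, ∀ x, |φ x| ≤ C) :
    TendstoInDistribution (S.scaledError φ) atTop (id : ℝ → ℝ) (fun N => S.particleLaw N n)
      (gaussianReal 0 (∑ k ∈ Finset.range (n + 1), S.V k (S.centered φ)).toNNReal) ∧
    ∀ k < n, ∀ ψ ∈ ({φ, S.centered φ} : Set (E → ℝ)),
      S.V k ψ ≤
        S.Γg * (∏ j ∈ Finset.Ico (k + 1) n,
          (S.growth j (F j) + S.Γg * opSupNorm fun f x =>
            kernelOp (S.K j) f x - S.metastableOp j (F j) (α j) f x)) *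
        supNorm φ ^ 2 := by
  obtain ⟨C, hC⟩ := hφ_bdd
  have hφ : IsBM φ C := ⟨hφ_meas, hC⟩
  refine ⟨S.tendstoInDistribution_scaledError hφ, fun k hk ψ hψ => ?_⟩
  have hB := fun j (hj : 1 ≤ j) (hjn : j < n) => SMCSampler.kernelOp_g_le (S := S) hjn
    (hF_meas j hj hjn) (hα_nonneg j hj hjn) (hα_sum j hj hjn)
  obtain ⟨D, hD⟩ := S.isBM_centered hφ
  have hψ' : (∃ D, IsBM ψ D) ∧ ∫ x, ψ x ^ 2 ∂(S.μ n) ≤ supNorm φ ^ 2 := by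
    rcases hψ with rfl | rfl
    · exact ⟨⟨C, hφ⟩, SMCSampler.integral_sq_le_supNorm_sq hφ⟩
    · exact ⟨⟨D, hD⟩, (SMCSampler.integral_centered_sq_le hφ).trans
        (SMCSampler.integral_sq_le_supNorm_sq hφ)⟩
  obtain ⟨⟨D', hD'⟩, hle⟩ := hψ'
  refine (SMCSampler.V_le hB hD' hk).trans (mul_le_mul_of_nonneg_left hle ?_)
  have : Nonempty E := (S.μ 0).nonempty_of_neZero
  -- Each factor dominates K_j g ≥ 0 at some point of E.
  refine mul_nonneg SMCSampler.Γg_nonneg (Finset.prod_nonneg fun j hj => ?_)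
  obtain ⟨hj1, hjn⟩ := Finset.mem_Ico.1 hj
  exact le_trans (integral_nonneg fun y => (S.g j y).coe_nonneg)
    (hB j (by omega) hjn (Classical.arbitrary E))
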